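/- Let $\phi:[0,\infty)\to[0,\infty)$ be nondecreasing and right-continuous with $\phi(0)=0$, $\phi(t)>0$ for $t>0$, $\lim_{t\to\infty}\phi(t)=\infty$, and suppose that there is $a>1$ with $u\phi(u)<a\Phi(u)$ for all $u>0$, where $\Phi(u)=\int_0^u\phi(t)\,dt$ is the associated Young function. Let $\Omega\subset\mathbb{R}^n$ be open, and let $L_\Phi(\Omega)$ be the Orlicz space of (classes of) measurable functions $u:\Omega\to\mathbb{R}$ with $\int_\Omega\Phi(|u|)\,dx<\infty$, with the Luxemburg norm \[\|u\|_{\Phi,\Omega}=\inf\Big\{\lambda>0:\int_\Omega\Phi(|u(x)|/\lambda)\,dx\le 1\Big\}.\] Let $W^1_\Phi(\Omega)$ be the closure, in the norm $\|u\|^1_{\Phi,\Omega}=\max\{\|u\|_{\Phi,\Omega},\|\partial_1u\|_{\Phi,\Omega},\dots,\|\partial_nu\|_{\Phi,\Omega}\}$, of the set of those $u\in C^1(\bar\Omega)$ (that is, $u\in C^1(\Omega)$ such that $u$ and $Du$ extend continuously to $\bar\Omega$) for which this norm is defined, i.e. $u,\partial_iu\in L_\Phi(\Omega)$. Let $f:\Omega\times\mathbb{R}^n\to\mathbb{R}$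 be such that $f(x,\cdot)$ is continuous for almost every $x\in\Omega$, $f(\cdot,p)$ is measurable for every $p\in\mathbb{R}^n$, $f(x,\cdot)$ is convex for every $x\in\Omega$, and, for some constants $c^1_f,c^2_f>0$, \[c^1_f\,\Phi(|p|)\le f(x,p)\le c^2_f\,(1+\Phi(|p|))\qquad\text{for all }(x,p)\in\Omega\times\mathbb{R}^n .\] Put $F(u,\Omega)=\int_\Omega f(x,Du(x))\,dx\in[0,\infty]$ for $u\in W^1_\Phi(\Omega)$. Then $F(\cdot,\Omega)$ is lower semicontinuous in the weak topology of $W^1_\Phi(\Omega)$; in particular, if $u_k\to u$ weakly in $W^1_\Phi(\Omega)$, then \[F(u,\Omega)\le\liminf_{k\to\infty}F(u_k,\Omega).\] -/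

import Mathlib

open MeasureTheory Filter Topology Set
open scoped ENNReal

noncomputable section

/-- A Young function `Φ(u) = ∫₀ᵘ φ(t) dt` (`u ≥ 0`), given by its density `φ` on `[0, ∞)`. The values
of `φ` on the negative half-line play no role. -/
structure YoungFunction where
  /-- the density `φ` -/
  φ : ℝ → ℝ
  φ_zero : φ 0 = 0
  φ_pos : ∀ t, 0 < t → 0 < φ t
  φ_mono : MonotoneOn φ (Ici 0)
  φ_rightCont : ∀ t, 0 ≤ t → ContinuousWithinAt φ (Ici t) t
  φ_tendsto : Tendsto φ atTop atTop
  growth : ∃ a : ℝ, 1 < a ∧ ∀ u, 0 < u → u * φ u < a * ∫ t in (0 : ℝ)..u, φ t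

namespace YoungFunction

/-- `Φ(u) = ∫₀ᵘ φ(t) dt`. -/
def toFun (Φ : YoungFunction) (u : ℝ) : ℝ := ∫ t in (0 : ℝ)..u, Φ.φ t

instance : CoeFun YoungFunction (fun _ => ℝ → ℝ) := ⟨toFun⟩

variable (Φ : YoungFunction)

lemma intInt {a b : ℝ} (ha : 0 ≤ a) (hb : 0 ≤ b) : IntervalIntegrable Φ.φ volume a b := by
  apply MonotoneOn.intervalIntegrable
  apply Φ.φ_mono.mono
  intro x hx
  exact le_trans (le_min ha hb) hx.1

lemma φ_nonneg {t : ℝ} (ht : 0 ≤ t) : 0 ≤ Φ.φ t := by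
  have := Φ.φ_mono (mem_Ici.2 le_rfl) (mem_Ici.2 ht) ht
  rwa [Φ.φ_zero] at this

lemma zero : Φ 0 = 0 := by simp [toFun]

/-- Subgradient inequality. -/
lemma subgrad {a b : ℝ} (ha : 0 ≤ a) (hb : 0 ≤ b) : Φ a + Φ.φ a * (b - a) ≤ Φ b := by
  have h1 : Φ b - Φ a = ∫ t in a..b, Φ.φ t :=
    intervalIntegral.integral_interval_sub_left (Φ.intInt le_rfl hb) (Φ.intInt le_rfl ha)
  rcases le_total a b with hab | hab
  · have := intervalIntegral.integral_mono_on hab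
      (intervalIntegrable_const (c := Φ.φ a) (μ := volume)) (Φ.intInt ha hb)
      (fun x hx => Φ.φ_mono (mem_Ici.2 ha) (mem_Ici.2 (ha.trans hx.1)) hx.1)
    rw [intervalIntegral.integral_const, smul_eq_mul] at this
    linarith
  · have := intervalIntegral.integral_mono_on hab (Φ.intInt hb ha)
      (intervalIntegrable_const (c := Φ.φ a) (μ := volume))
      (fun x hx => Φ.φ_mono (mem_Ici.2 (hb.trans hx.1)) (mem_Ici.2 ha) hx.2)
    rw [intervalIntegral.integral_const, smul_eq_mul] at this
    rw [intervalIntegral.integral_symm] at h1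
    linarith

lemma mono {a b : ℝ} (ha : 0 ≤ a) (hab : a ≤ b) : Φ a ≤ Φ b := by
  have := Φ.subgrad ha (ha.trans hab)
  nlinarith [mul_nonneg (Φ.φ_nonneg ha) (sub_nonneg.2 hab)]

lemma nonneg {a : ℝ} (ha : 0 ≤ a) : 0 ≤ Φ a := by
  simpa [Φ.zero] using Φ.mono le_rfl ha

lemma pos {a : ℝ} (ha : 0 < a) : 0 < Φ a := by
  have h := Φ.subgrad (a := a / 2) (b := a) (by positivity) ha.le
  have h2 := Φ.φ_pos (a / 2) (by positivity)
  have h3 := Φ.nonneg (a := a / 2) (by positivity)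
  nlinarith [mul_pos h2 (show 0 < a - a / 2 by linarith)]

lemma convex {a b s t : ℝ} (ha : 0 ≤ a) (hb : 0 ≤ b) (hs : 0 ≤ s) (ht : 0 ≤ t) (hst : s + t = 1) :
    Φ (s * a + t * b) ≤ s * Φ a + t * Φ b := by
  have hc : 0 ≤ s * a + t * b := by positivity
  have h1 := mul_le_mul_of_nonneg_left (Φ.subgrad hc ha) hs
  have h2 := mul_le_mul_of_nonneg_left (Φ.subgrad hc hb) ht
  obtain rfl : t = 1 - s := by linarith
  linarith

lemma mul_le {a s : ℝ} (ha : 0 ≤ a) (hs : 0 ≤ s) (hs1 : s ≤ 1) : Φ (s * a) ≤ s * Φ a := by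
  have := Φ.convex ha le_rfl hs (sub_nonneg.2 hs1) (by ring)
  simpa [Φ.zero] using this

/-- The doubling property: every dilation is controlled. -/
lemma exists_dilation {r : ℝ} (hr : 0 ≤ r) : ∃ k : ℝ, 0 ≤ k ∧ ∀ u, 0 ≤ u → Φ (r * u) ≤ k * Φ u := by
  obtain ⟨a, ha, hgr⟩ := Φ.growth
  set l : ℝ := 2 * a / (2 * a - 1) with hl
  have hd : 0 < 2 * a - 1 := by linarith
  have hl1 : 1 < l := by rw [hl, lt_div_iff₀ hd]; linarith
  have hla : (l - 1) * (2 * a) = l := by rw [hl]; field_simp; ring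
  have step : ∀ u, 0 ≤ u → Φ (l * u) ≤ 2 * Φ u := by
    intro u hu
    rcases hu.eq_or_lt with rfl | hu
    · simp [Φ.zero]
    have hlu : 0 < l * u := by positivity
    have h1 := Φ.subgrad hlu.le hu.le
    have h2 : l * u * Φ.φ (l * u) < a * Φ (l * u) := hgr _ hlu
    have h3 : l * (u * Φ.φ (l * u)) < a * Φ (l * u) := by linarith
    have h4 : (l - 1) * (2 * a) * (u * Φ.φ (l * u)) < a * Φ (l * u) := by rw [hla]; exact h3
    have h5 : 2 * ((l - 1) * (u * Φ.φ (l * u))) < Φ (l * u) := by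
      by_contra hcon
      push Not at hcon
      nlinarith
    nlinarith
  have iter : ∀ m : ℕ, ∀ u, 0 ≤ u → Φ (l ^ m * u) ≤ 2 ^ m * Φ u := by
    intro m
    induction m with
    | zero => intro u _; simp
    | succ m ih =>
      intro u hu
      have e : l ^ (m + 1) * u = l * (l ^ m * u) := by ring
      rw [e]
      have := step (l ^ m * u) (by positivity)
      have := ih u hu
      rw [pow_succ]
      linarith
  obtain ⟨m, hm⟩ := pow_unbounded_of_one_lt |r| hl1
  refine ⟨2 ^ m, by positivity, fun u hu => ?_⟩
  rw [abs_of_nonneg hr] at hm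
  exact (Φ.mono (by positivity) (mul_le_mul_of_nonneg_right hm.le hu)).trans (iter m u hu)

end YoungFunction

section Orlicz

variable {α : Type*} [MeasurableSpace α]

/-- The modular `ρ(u, Φ) = ∫ Φ(|u|) dμ`, with values in `[0, ∞]`. -/
def orliczModular (Φ : YoungFunction) (μ : Measure α) (u : α → ℝ) : ℝ≥0∞ :=
  ∫⁻ x, ENNReal.ofReal (Φ |u x|) ∂μ

variable {Φ : YoungFunction} {μ : Measure α}

lemma orliczModular_congr {u v : α → ℝ} (h : u =ᵐ[μ] v) :
    orliczModular Φ μ u = orliczModular Φ μ v :=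
  lintegral_congr_ae (h.mono fun x hx => by simp only [hx])

lemma YoungFunction.measurable_abs (Φ : YoungFunction) : Measurable fun t : ℝ => Φ |t| := by
  have h : Measurable fun t : ℝ => Φ (max t 0) :=
    Monotone.measurable fun a b hab => Φ.mono (le_max_right _ _) (max_le_max_right 0 hab)
  have := h.comp (measurable_id.abs (α := ℝ))
  simpa [Function.comp_def] using this

lemma aemeas_modular {u : α → ℝ} (hu : AEMeasurable u μ) :
    AEMeasurable (fun x => ENNReal.ofReal (Φ |u x|)) μ :=
  (Φ.measurable_abs.comp_aemeasurable hu).ennreal_ofReal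

lemma orliczModular_const_mul_le {k c : ℝ} (hk : 0 ≤ k)
    (h : ∀ t, 0 ≤ t → Φ (|c| * t) ≤ k * Φ t) (u : α → ℝ) :
    orliczModular Φ μ (fun x => c * u x) ≤ ENNReal.ofReal k * orliczModular Φ μ u := by
  unfold orliczModular
  rw [← lintegral_const_mul' _ _ ENNReal.ofReal_ne_top]
  refine lintegral_mono fun x => ?_
  rw [← ENNReal.ofReal_mul hk, abs_mul]
  exact ENNReal.ofReal_le_ofReal (h _ (abs_nonneg _))

lemma orliczModular_convex {s t : ℝ} (hs : 0 ≤ s) (ht : 0 ≤ t) (hst : s + t = 1)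
    {u v : α → ℝ} (hu : AEMeasurable u μ) :
    orliczModular Φ μ (fun x => s * u x + t * v x) ≤
      ENNReal.ofReal s * orliczModular Φ μ u + ENNReal.ofReal t * orliczModular Φ μ v := by
  unfold orliczModular
  rw [← lintegral_const_mul' _ _ ENNReal.ofReal_ne_top,
    ← lintegral_const_mul' _ _ ENNReal.ofReal_ne_top,
    ← lintegral_add_left' ((aemeas_modular hu).const_mul _)]
  refine lintegral_mono fun x => ?_
  rw [← ENNReal.ofReal_mul hs, ← ENNReal.ofReal_mul ht, ← ENNReal.ofReal_add
    (mul_nonneg hs (Φ.nonneg (abs_nonneg _))) (mul_nonneg ht (Φ.nonneg (abs_nonneg _)))]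
  refine ENNReal.ofReal_le_ofReal (le_trans (Φ.mono (abs_nonneg _) ?_)
    (Φ.convex (abs_nonneg _) (abs_nonneg _) hs ht hst))
  calc |s * u x + t * v x| ≤ |s * u x| + |t * v x| := abs_add_le _ _
    _ = _ := by rw [abs_mul, abs_mul, abs_of_nonneg hs, abs_of_nonneg ht]

lemma orliczModular_const_mul_lt_top (c : ℝ) {u : α → ℝ} (hu : orliczModular Φ μ u < ∞) :
    orliczModular Φ μ (fun x => c * u x) < ∞ := by
  obtain ⟨k, hk, h⟩ := Φ.exists_dilation (abs_nonneg c)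
  exact (orliczModular_const_mul_le hk h u).trans_lt (ENNReal.mul_lt_top ENNReal.ofReal_lt_top hu)

/-- The Orlicz space `L_Φ(μ)`: the (classes of) measurable functions with `∫ Φ(|u|) dμ < ∞`. It is a
linear space because `Φ` is doubling. -/
def OrliczSpace (Φ : YoungFunction) (μ : Measure α) : Submodule ℝ (α →ₘ[μ] ℝ) where
  carrier := {u | orliczModular Φ μ u < ∞}
  zero_mem' := by
    change orliczModular Φ μ _ < ∞
    rw [orliczModular_congr (AEEqFun.coeFn_zero (μ := μ) (β := ℝ))]
    simp [orliczModular, Φ.zero]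
  add_mem' := by
    intro u v hu hv
    change orliczModular Φ μ _ < ∞
    have h2 := (orliczModular_convex (Φ := Φ) (μ := μ) (s := 1 / 2) (t := 1 / 2) (by norm_num)
      (by norm_num) (by norm_num) (u := fun x => 2 * u x) (v := fun x => 2 * v x)
      (u.aestronglyMeasurable.aemeasurable.const_mul 2))
    rw [orliczModular_congr (v := fun x => 1 / 2 * (2 * u x) + 1 / 2 * (2 * v x))]
    · exact h2.trans_lt (ENNReal.add_lt_top.2
        ⟨ENNReal.mul_lt_top ENNReal.ofReal_lt_top (orliczModular_const_mul_lt_top 2 hu),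
          ENNReal.mul_lt_top ENNReal.ofReal_lt_top (orliczModular_const_mul_lt_top 2 hv)⟩)
    · filter_upwards [AEEqFun.coeFn_add u v] with x hx
      rw [hx, Pi.add_apply]
      ring
  smul_mem' := by
    intro c u hu
    change orliczModular Φ μ _ < ∞
    rw [orliczModular_congr (AEEqFun.coeFn_smul c u)]
    exact orliczModular_const_mul_lt_top c hu

/-- The Luxemburg norm `inf {λ > 0 : ∫ Φ(|u|/λ) dμ ≤ 1}`. -/
def luxemburgNorm (Φ : YoungFunction) (μ : Measure α) (u : α → ℝ) : ℝ :=
  sInf {l : ℝ | 0 < l ∧ orliczModular Φ μ (fun x => u x / l) ≤ 1}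

lemma luxemburgNorm_congr {u v : α → ℝ} (h : u =ᵐ[μ] v) :
    luxemburgNorm Φ μ u = luxemburgNorm Φ μ v := by
  unfold luxemburgNorm
  congr 1
  ext l
  simp only [mem_ofPred_eq]
  rw [orliczModular_congr (v := fun x => v x / l) (h.mono fun x hx => by simp only [hx])]

lemma luxemburgNorm_nonneg (u : α → ℝ) : 0 ≤ luxemburgNorm Φ μ u :=
  Real.sInf_nonneg fun _ hl => hl.1.le

lemma luxemburg_bddBelow (u : α → ℝ) :
    BddBelow {l : ℝ | 0 < l ∧ orliczModular Φ μ (fun x => u x / l) ≤ 1} :=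
  ⟨0, fun _ hl => hl.1.le⟩

lemma luxemburg_nonempty {u : α → ℝ} (hu : orliczModular Φ μ u < ∞) :
    {l : ℝ | 0 < l ∧ orliczModular Φ μ (fun x => u x / l) ≤ 1}.Nonempty := by
  set r := (orliczModular Φ μ u).toReal with hr
  have hr0 : 0 ≤ r := ENNReal.toReal_nonneg
  have hl : 0 < r + 1 := by linarith
  have hi : 0 ≤ (r + 1)⁻¹ := by positivity
  have hi1 : (r + 1)⁻¹ ≤ 1 := inv_le_one_of_one_le₀ (by linarith)
  refine ⟨r + 1, hl, ?_⟩
  have h := orliczModular_const_mul_le (Φ := Φ) (μ := μ) (c := (r + 1)⁻¹) hi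
    (fun t ht => by rw [abs_of_nonneg hi]; exact Φ.mul_le ht hi hi1) u
  simp only [div_eq_inv_mul]
  refine h.trans ?_
  rw [← ENNReal.ofReal_toReal hu.ne, ← hr, ← ENNReal.ofReal_mul hi]
  refine ENNReal.ofReal_le_one.2 ?_
  rw [inv_mul_le_iff₀ hl]
  linarith

/-- Above the norm, the modular of the quotient is at most one. -/
lemma modular_div_le_one {u : α → ℝ} (hu : orliczModular Φ μ u < ∞) {l : ℝ}
    (hl : luxemburgNorm Φ μ u < l) : 0 < l ∧ orliczModular Φ μ (fun x => u x / l) ≤ 1 := by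
  obtain ⟨m, ⟨hm0, hm⟩, hml⟩ := exists_lt_of_csInf_lt (luxemburg_nonempty hu) hl
  have hl0 : 0 < l := hm0.trans hml
  refine ⟨hl0, le_trans (lintegral_mono fun x => ?_) hm⟩
  refine ENNReal.ofReal_le_ofReal (Φ.mono (abs_nonneg _) ?_)
  rw [abs_div, abs_div, abs_of_pos hl0, abs_of_pos hm0]
  exact div_le_div_of_nonneg_left (abs_nonneg _) hm0 hml.le

lemma luxemburgNorm_add_le {u v : α → ℝ} (hu : orliczModular Φ μ u < ∞)
    (hv : orliczModular Φ μ v < ∞) (hum : AEMeasurable u μ) :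
    luxemburgNorm Φ μ (fun x => u x + v x) ≤ luxemburgNorm Φ μ u + luxemburgNorm Φ μ v := by
  refine le_of_forall_pos_le_add fun ε hε => ?_
  obtain ⟨ha, ha'⟩ := modular_div_le_one hu (lt_add_of_pos_right _ (half_pos hε))
  obtain ⟨hb, hb'⟩ := modular_div_le_one hv (lt_add_of_pos_right _ (half_pos hε))
  set a := luxemburgNorm Φ μ u + ε / 2
  set b := luxemburgNorm Φ μ v + ε / 2
  have hab : 0 < a + b := by positivity
  have hst : a / (a + b) + b / (a + b) = 1 := by rw [← add_div, div_self hab.ne']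
  have h := orliczModular_convex (Φ := Φ) (μ := μ) (s := a / (a + b)) (t := b / (a + b))
    (by positivity) (by positivity) hst (u := fun x => u x / a) (v := fun x => v x / b)
    (hum.div_const a)
  have key : luxemburgNorm Φ μ (fun x => u x + v x) ≤ a + b := by
    refine csInf_le (luxemburg_bddBelow _) ⟨hab, ?_⟩
    have e : (fun x => (u x + v x) / (a + b)) =
        fun x => a / (a + b) * (u x / a) + b / (a + b) * (v x / b) := by
      ext x
      field_simp
    rw [e]
    refine h.trans ((add_le_add (mul_le_mul_right ha' _) (mul_le_mul_right hb' _)).trans ?_)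
    rw [mul_one, mul_one, ← ENNReal.ofReal_add (by positivity) (by positivity), hst,
      ENNReal.ofReal_one]
  simp only [a, b] at key
  linarith

lemma luxemburgNorm_zero : luxemburgNorm Φ μ (fun _ => 0) = 0 := by
  refine le_antisymm (le_of_forall_pos_le_add fun ε hε => ?_) (luxemburgNorm_nonneg _)
  rw [zero_add]
  refine csInf_le (luxemburg_bddBelow _) ⟨hε, ?_⟩
  simp [orliczModular, Φ.zero]

lemma luxemburgNorm_const_mul_le (c : ℝ) {u : α → ℝ} (hu : orliczModular Φ μ u < ∞) :
    luxemburgNorm Φ μ (fun x => c * u x) ≤ |c| * luxemburgNorm Φ μ u := by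
  rcases eq_or_ne c 0 with rfl | hc
  · simp [luxemburgNorm_zero]
  have hc' : 0 < |c| := abs_pos.2 hc
  refine le_of_forall_pos_le_add fun ε hε => ?_
  obtain ⟨ha, ha'⟩ := modular_div_le_one hu (lt_add_of_pos_right _ (div_pos hε hc'))
  set a := luxemburgNorm Φ μ u + ε / |c| with hadef
  have e : |c| * luxemburgNorm Φ μ u + ε = |c| * a := by rw [hadef]; field_simp
  rw [e]
  refine csInf_le (luxemburg_bddBelow _) ⟨mul_pos hc' ha, le_of_eq_of_le ?_ ha'⟩
  refine lintegral_congr fun x => ?_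
  congr 2
  rw [abs_div, abs_mul, abs_mul, abs_abs, abs_div, mul_div_mul_left _ _ hc'.ne']

lemma luxemburgNorm_const_mul (c : ℝ) {u : α → ℝ} (hu : orliczModular Φ μ u < ∞) :
    luxemburgNorm Φ μ (fun x => c * u x) = |c| * luxemburgNorm Φ μ u := by
  refine le_antisymm (luxemburgNorm_const_mul_le c hu) ?_
  rcases eq_or_ne c 0 with rfl | hc
  · simp [luxemburgNorm_zero]
  have hc' : 0 < |c| := abs_pos.2 hc
  have h := luxemburgNorm_const_mul_le c⁻¹ (orliczModular_const_mul_lt_top c hu)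
  have e : (fun x => c⁻¹ * (c * u x)) = u := by
    ext x
    field_simp
  rw [e, abs_inv] at h
  rwa [← le_inv_mul_iff₀ hc']

lemma ae_zero_of_luxemburgNorm_eq_zero {u : α → ℝ} (hum : AEMeasurable u μ)
    (hu : orliczModular Φ μ u < ∞) (h : luxemburgNorm Φ μ u = 0) : u =ᵐ[μ] fun _ => 0 := by
  have h0 : orliczModular Φ μ u = 0 := by
    refine le_antisymm (ENNReal.le_of_forall_pos_le_add fun ε hε _ => ?_) bot_le
    set d : ℝ := min ε 1
    have hd : 0 < d := lt_min (by exact_mod_cast hε) one_pos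
    have h1 := (modular_div_le_one hu (l := d) (by rw [h]; exact hd)).2
    have h2 := orliczModular_const_mul_le (Φ := Φ) (μ := μ) (c := d) hd.le
      (fun t ht => by rw [abs_of_pos hd]; exact Φ.mul_le ht hd.le (min_le_right _ _))
      (fun x => u x / d)
    have e : (fun x => d * (u x / d)) = u := by
      ext x
      field_simp
    rw [e] at h2
    rw [zero_add]
    calc orliczModular Φ μ u ≤ ENNReal.ofReal d * 1 := h2.trans (mul_le_mul_right h1 _)
      _ ≤ ε := by
        rw [mul_one]
        exact ENNReal.ofReal_le_of_le_toReal (min_le_left _ _)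
  have h3 := (lintegral_eq_zero_iff' (aemeas_modular (Φ := Φ) hum)).1 h0
  filter_upwards [h3] with x hx
  by_contra hne
  exact (ENNReal.ofReal_pos.2 (Φ.pos (abs_pos.2 hne))).ne' hx

instance : Norm (OrliczSpace Φ μ) := ⟨fun u => luxemburgNorm Φ μ u.1⟩

lemma orliczNormedSpaceCore : NormedSpace.Core ℝ (OrliczSpace Φ μ) where
  norm_nonneg u := luxemburgNorm_nonneg _
  norm_smul c u := by
    change luxemburgNorm Φ μ (c • u.1 : α →ₘ[μ] ℝ) = |c| * luxemburgNorm Φ μ u.1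
    rw [luxemburgNorm_congr (AEEqFun.coeFn_smul c u.1)]
    exact luxemburgNorm_const_mul c u.2
  norm_triangle u v := by
    change luxemburgNorm Φ μ (u.1 + v.1 : α →ₘ[μ] ℝ) ≤
      luxemburgNorm Φ μ u.1 + luxemburgNorm Φ μ v.1
    rw [luxemburgNorm_congr (AEEqFun.coeFn_add u.1 v.1)]
    exact luxemburgNorm_add_le u.2 v.2 u.1.aestronglyMeasurable.aemeasurable
  norm_eq_zero_iff u := by
    change luxemburgNorm Φ μ u.1 = 0 ↔ u = 0
    constructor
    · intro h
      apply Subtype.ext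
      apply AEEqFun.ext
      exact (ae_zero_of_luxemburgNorm_eq_zero u.1.aestronglyMeasurable.aemeasurable u.2 h).trans
        AEEqFun.coeFn_zero.symm
    · rintro rfl
      have : luxemburgNorm Φ μ ((0 : α →ₘ[μ] ℝ) : α → ℝ) = luxemburgNorm Φ μ (fun _ => 0) :=
        luxemburgNorm_congr AEEqFun.coeFn_zero
      exact this.trans luxemburgNorm_zero

instance : NormedAddCommGroup (OrliczSpace Φ μ) :=
  NormedAddCommGroup.ofCore (orliczNormedSpaceCore (Φ := Φ) (μ := μ))

instance : NormedSpace ℝ (OrliczSpace Φ μ) :=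
  NormedSpace.ofCore (orliczNormedSpaceCore (Φ := Φ) (μ := μ))

end Orlicz

section OrliczSobolev

variable {n : ℕ}

/-- `w ∈ C¹(Ω̄)`: `w` is `C¹` in the open set `Ω`, and `w` and `Dw` have continuous extensions to the
closure of `Ω`. -/
def IsC1Closure (Ω : Set (EuclideanSpace ℝ (Fin n))) (w : EuclideanSpace ℝ (Fin n) → ℝ) : Prop :=
  ContDiffOn ℝ 1 w Ω ∧
  (∃ w' : EuclideanSpace ℝ (Fin n) → ℝ, ContinuousOn w' (closure Ω) ∧ EqOn w w' Ω) ∧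
  ∃ g : EuclideanSpace ℝ (Fin n) → (EuclideanSpace ℝ (Fin n) →L[ℝ] ℝ),
    ContinuousOn g (closure Ω) ∧ EqOn (fderiv ℝ w) g Ω

/-- The partial derivative `∂w/∂xᵢ`. -/
def partialDeriv (i : Fin n) (w : EuclideanSpace ℝ (Fin n) → ℝ) (x : EuclideanSpace ℝ (Fin n)) :
    ℝ :=
  fderiv ℝ w x (EuclideanSpace.single i 1)

/-- The Orlicz space `L_Φ(Ω)` with respect to Lebesgue measure on `Ω`. -/
abbrev LPhi (Φ : YoungFunction) (Ω : Set (EuclideanSpace ℝ (Fin n))) : Type :=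
  OrliczSpace Φ ((volume : Measure (EuclideanSpace ℝ (Fin n))).restrict Ω)

/-- The space of all `(w, (∂₁w, …, ∂ₙw))` with `w ∈ C¹(Ω̄)`, where `w` and its first derivatives are in
`L_Φ(Ω)`. The norm of the ambient product is the maximum of the Luxemburg norms of the components,
so that here it is `max_{|β| ≤ 1} ‖D^β w‖_Φ`. -/
def c1Graph (Φ : YoungFunction) {Ω : Set (EuclideanSpace ℝ (Fin n))} (hΩ : IsOpen Ω) :
    Submodule ℝ (LPhi Φ Ω × (Fin n → LPhi Φ Ω)) where
  carrier := {p | ∃ w : EuclideanSpace ℝ (Fin n) → ℝ, IsC1Closure Ω w ∧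
    p.1.1 =ᵐ[volume.restrict Ω] w ∧ ∀ i, (p.2 i).1 =ᵐ[volume.restrict Ω] partialDeriv i w}
  zero_mem' := by
    refine ⟨fun _ => 0, ⟨contDiffOn_const, ⟨fun _ => 0, continuousOn_const, fun _ _ => rfl⟩,
      fun _ => 0, continuousOn_const, fun x _ => by simp⟩, AEEqFun.coeFn_zero, fun i => ?_⟩
    have : partialDeriv i (fun _ : EuclideanSpace ℝ (Fin n) => (0 : ℝ)) = 0 := by
      ext x
      simp [partialDeriv]
    rw [this]
    exact AEEqFun.coeFn_zero
  add_mem' := by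
    rintro p q ⟨w, ⟨hw, ⟨w', hw', ew⟩, g, hg, eg⟩, hp, hp'⟩
      ⟨v, ⟨hv, ⟨v', hv', ev⟩, k, hk, ek⟩, hq, hq'⟩
    have hd : ∀ x ∈ Ω, fderiv ℝ (fun y => w y + v y) x = fderiv ℝ w x + fderiv ℝ v x :=
      fun x hx => fderiv_fun_add
        ((hw.differentiableOn one_ne_zero).differentiableAt (hΩ.mem_nhds hx))
        ((hv.differentiableOn one_ne_zero).differentiableAt (hΩ.mem_nhds hx))
    refine ⟨fun x => w x + v x, ⟨hw.add hv, ⟨fun x => w' x + v' x, hw'.add hv',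
      fun x hx => by simp only [ew hx, ev hx]⟩, fun x => g x + k x, hg.add hk,
      fun x hx => by rw [hd x hx, eg hx, ek hx]⟩, ?_, fun i => ?_⟩
    · filter_upwards [AEEqFun.coeFn_add p.1.1 q.1.1, hp, hq] with x hx h1 h2
      rw [← h1, ← h2]
      exact hx
    · filter_upwards [AEEqFun.coeFn_add (p.2 i).1 (q.2 i).1, hp' i, hq' i,
        ae_restrict_mem hΩ.measurableSet] with x hx h1 h2 hxΩ
      refine hx.trans ?_
      rw [Pi.add_apply, h1, h2]
      simp [partialDeriv, hd x hxΩ]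
  smul_mem' := by
    rintro c p ⟨w, ⟨hw, ⟨w', hw', ew⟩, g, hg, eg⟩, hp, hp'⟩
    have hd : ∀ x ∈ Ω, fderiv ℝ (fun y => c • w y) x = c • fderiv ℝ w x :=
      fun x hx => fderiv_fun_const_smul
        ((hw.differentiableOn one_ne_zero).differentiableAt (hΩ.mem_nhds hx)) c
    refine ⟨fun x => c • w x, ⟨hw.const_smul c, ⟨fun x => c • w' x,
      hw'.const_smul c, fun x hx => by simp only [ew hx]⟩, fun x => c • g x,
      hg.const_smul c, fun x hx => by rw [hd x hx, eg hx]⟩, ?_, fun i => ?_⟩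
    · filter_upwards [AEEqFun.coeFn_smul c p.1.1, hp] with x hx h1
      rw [← h1]
      exact hx
    · filter_upwards [AEEqFun.coeFn_smul c (p.2 i).1, hp' i,
        ae_restrict_mem hΩ.measurableSet] with x hx h1 hxΩ
      refine hx.trans ?_
      rw [Pi.smul_apply, h1]
      change c • fderiv ℝ w x _ = fderiv ℝ (fun y => c • w y) x _
      rw [hd x hxΩ]
      rfl

/-- The Orlicz–Sobolev space `W¹_Φ(Ω)`: the closure of `C¹(Ω̄)` in the norm
`max_{|β| ≤ 1} ‖D^β u‖_Φ`. An element is recorded as a function together with its first partial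
derivatives, `(u, (∂₁u, …, ∂ₙu)) ∈ L_Φ(Ω) × L_Φ(Ω)ⁿ`, and the norm is the one of the product. -/
abbrev OrliczSobolev (Φ : YoungFunction) {Ω : Set (EuclideanSpace ℝ (Fin n))} (hΩ : IsOpen Ω) :
    Submodule ℝ (LPhi Φ Ω × (Fin n → LPhi Φ Ω)) :=
  (c1Graph Φ hΩ).topologicalClosure

variable {Φ : YoungFunction} {Ω : Set (EuclideanSpace ℝ (Fin n))} {hΩ : IsOpen Ω}

/-- The gradient `Du(x)` of an element of `W¹_Φ(Ω)`. -/
def OrliczSobolev.grad (u : OrliczSobolev Φ hΩ) (x : EuclideanSpace ℝ (Fin n)) :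
    EuclideanSpace ℝ (Fin n) :=
  WithLp.toLp 2 fun i => (u.1.2 i).1 x

/-- Convex Carathéodory integrands `f(x, p)` on `Ω × ℝⁿ` of `Φ`-growth,
`c₁ Φ(|p|) ≤ f(x, p) ≤ c₂ (1 + Φ(|p|))`. -/
structure IsConvexIntegrand (Φ : YoungFunction) (Ω : Set (EuclideanSpace ℝ (Fin n))) (c₁ c₂ : ℝ)
    (f : EuclideanSpace ℝ (Fin n) → EuclideanSpace ℝ (Fin n) → ℝ) : Prop where
  continuous : ∀ᵐ x ∂(volume.restrict Ω), Continuous (f x)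
  measurable : ∀ p, AEMeasurable (fun x => f x p) (volume.restrict Ω)
  convex : ∀ x ∈ Ω, ConvexOn ℝ univ (f x)
  lower : ∀ x ∈ Ω, ∀ p, c₁ * Φ ‖p‖ ≤ f x p
  upper : ∀ x ∈ Ω, ∀ p, f x p ≤ c₂ * (1 + Φ ‖p‖)

/-- `F(u, Ω) = ∫_Ω f(x, Du(x)) dx ∈ [0, ∞]`, for integrands `f ≥ 0`. -/
def energy (f : EuclideanSpace ℝ (Fin n) → EuclideanSpace ℝ (Fin n) → ℝ)
    (u : OrliczSobolev Φ hΩ) : ℝ≥0∞ :=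
  ∫⁻ x in Ω, ENNReal.ofReal (f x (OrliczSobolev.grad u x))

end OrliczSobolev

end

/-! ### Measurability of superpositions with Carathéodory functions. -/

section Caratheodory

variable {α β : Type*} [MeasurableSpace α] {μ : Measure α}

/-! Lower semicontinuity means that every sublevel set of the energy is closed, and in a normed
space a convex set that is norm closed is weakly closed (Mazur, via Hahn–Banach). So only
norm-topological work is needed, and weak convergence is never analysed directly.

Sublevel sets are convex because `f x` is convex and the gradient is linear
(`IsConvexIntegrand.convex_sublevel`). They are norm closed (`IsConvexIntegrand.isClosed_sublevel`)
by Fatou's lemma: norm convergence in the Orlicz space gives convergence in measure by a Chebyshev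
inequality, hence almost everywhere convergence of the gradients along a subsequence
(`OrliczSobolev.exists_subseq_grad_tendsto`), and continuity of `f x` carries this over to the
integrands. Their measurability comes from `aemeasurable_superposition`. -/

lemma aemeasurable_comp_simpleFunc (s : SimpleFunc α β) {f : α → β → ℝ}
    (hf : ∀ p, AEMeasurable (fun x => f x p) μ) : AEMeasurable (fun x => f x (s x)) μ := by
  refine ⟨fun x => (hf (s x)).mk _ x,
    s.measurable_bind (fun p x => (hf p).mk _ x) fun p => (hf p).measurable_mk, ?_⟩
  -- The exceptional null set depends on `p`, but only the finitely many values of `s` matter.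
  have h : ∀ᵐ x ∂μ, ∀ p ∈ s.range, f x p = (hf p).mk _ x :=
    (Finset.eventually_all s.range).2 fun p _ => (hf p).ae_eq_mk
  filter_upwards [h] with x hx
  exact hx _ (s.mem_range_self x)

/-- Superposition with a Carathéodory function preserves measurability. -/
lemma aemeasurable_superposition [PseudoEMetricSpace β] [SecondCountableTopology β]
    [MeasurableSpace β] [OpensMeasurableSpace β] [Nonempty β] {f : α → β → ℝ} {g : α → β}
    (hcont : ∀ᵐ x ∂μ, Continuous (f x)) (hmeas : ∀ p, AEMeasurable (fun x => f x p) μ)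
    (hg : AEMeasurable g μ) : AEMeasurable (fun x => f x (g x)) μ := by
  obtain ⟨b⟩ := ‹Nonempty β›
  -- Simple functions approximate a measurable representative of `g` pointwise, and continuity of `f
  -- x` passes the limit through `f`.
  refine aemeasurable_of_tendsto_metrizable_ae atTop
    (fun k => aemeasurable_comp_simpleFunc
      (SimpleFunc.approxOn hg.mk hg.measurable_mk univ b (mem_univ b) k) hmeas) ?_
  filter_upwards [hcont, hg.ae_eq_mk] with x hx hgx
  rw [hgx]
  exact (hx.tendsto _).comp
    (SimpleFunc.tendsto_approxOn hg.measurable_mk (mem_univ b) (by simp))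

end Caratheodory

/-! ### From Luxemburg norm convergence to convergence in measure. -/

section OrliczConvergence

variable {α : Type*} [MeasurableSpace α] {Φ : YoungFunction} {μ : Measure α}

/-- Chebyshev's inequality in Orlicz spaces. -/
lemma meas_ge_le_of_luxemburgNorm_lt {u : α → ℝ} (hum : AEMeasurable u μ)
    (hu : orliczModular Φ μ u < ∞) {ε l : ℝ} (hε : 0 < ε) (hl : luxemburgNorm Φ μ u < l)
    (hl1 : l ≤ 1) : μ {x | ε ≤ |u x|} ≤ ENNReal.ofReal (l / Φ ε) := by
  obtain ⟨hl0, hm⟩ := modular_div_le_one hu hl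
  have hΦ := Φ.pos hε
  have hc : 0 < Φ ε / l := div_pos hΦ hl0
  -- Convexity and `Φ 0 = 0` give `Φ |u| ≤ l * Φ (|u| / l)` for `l ≤ 1`, so the quotient has large
  -- `Φ` wherever `|u|` is at least `ε`; Markov's inequality then applies to a modular that is at
  -- most one.
  have hsub : {x | ε ≤ |u x|} ⊆
      {x | ENNReal.ofReal (Φ ε / l) ≤ ENNReal.ofReal (Φ |u x / l|)} := by
    intro x hx
    refine ENNReal.ofReal_le_ofReal ?_
    rw [div_le_iff₀' hl0, abs_div, abs_of_pos hl0]
    have h := Φ.mul_le (a := |u x| / l) (by positivity) hl0.le hl1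
    rw [mul_div_cancel₀ _ hl0.ne'] at h
    exact (Φ.mono hε.le hx).trans h
  have h := (mul_meas_ge_le_lintegral₀ (aemeas_modular (Φ := Φ) (hum.div_const l))
    (ENNReal.ofReal (Φ ε / l))).trans hm
  calc μ {x | ε ≤ |u x|} ≤ _ := measure_mono hsub
    _ ≤ (ENNReal.ofReal (Φ ε / l))⁻¹ := by
      rw [mul_comm] at h
      simpa using ENNReal.le_div_iff_mul_le (Or.inl (ENNReal.ofReal_pos.2 hc).ne')
        (Or.inl ENNReal.ofReal_ne_top) |>.2 h
    _ = _ := by rw [← ENNReal.ofReal_inv_of_pos hc, inv_div]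

/-- Norm convergence in an Orlicz space implies convergence in measure. -/
lemma OrliczSpace.tendstoInMeasure {ι : Type*} {L : Filter ι} {u : ι → OrliczSpace Φ μ}
    {v : OrliczSpace Φ μ} (h : Tendsto u L (𝓝 v)) :
    TendstoInMeasure μ (fun k => (u k).1) L v.1 := by
  rw [tendstoInMeasure_iff_norm]
  intro ε hε
  have hΦ := Φ.pos hε
  have hn : Tendsto (fun k => ‖u k - v‖) L (𝓝 0) := tendsto_iff_norm_sub_tendsto_zero.1 h
  have hbound : ∀ k, ‖u k - v‖ < 1 →
      μ {x | ε ≤ ‖(u k).1 x - v.1 x‖} ≤ ENNReal.ofReal (‖u k - v‖ / Φ ε) := by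
    intro k hk
    have hae : μ {x | ε ≤ ‖(u k).1 x - v.1 x‖} = μ {x | ε ≤ |(u k - v).1 x|} := by
      refine measure_congr ?_
      filter_upwards [AEEqFun.coeFn_sub (u k).1 v.1] with x hx
      refine propext ?_
      change ε ≤ ‖(u k).1 x - v.1 x‖ ↔ ε ≤ |((u k).1 - v.1 : α →ₘ[μ] ℝ) x|
      rw [hx, Pi.sub_apply, Real.norm_eq_abs]
    rw [hae]
    -- Chebyshev is available only for `l` strictly above the norm (which may be zero), so the bound
    -- is obtained by letting `l` decrease to it.
    have hlim : Tendsto (fun l : ℝ => ENNReal.ofReal (l / Φ ε)) (𝓝[>] ‖u k - v‖)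
        (𝓝 (ENNReal.ofReal (‖u k - v‖ / Φ ε))) :=
      (ENNReal.continuous_ofReal.comp (continuous_id.div_const _)).continuousWithinAt
    refine ge_of_tendsto hlim ?_
    filter_upwards [Ioc_mem_nhdsGT hk] with l hl
    exact meas_ge_le_of_luxemburgNorm_lt (u k - v).1.aestronglyMeasurable.aemeasurable
      (u k - v).2 hε hl.1 hl.2
  have hlim : Tendsto (fun k => ENNReal.ofReal (‖u k - v‖ / Φ ε)) L (𝓝 0) := by
    simpa using ENNReal.tendsto_ofReal (hn.div_const (Φ ε))
  refine tendsto_of_tendsto_of_tendsto_of_le_of_le' tendsto_const_nhds hlim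
    (Eventually.of_forall fun _ => zero_le) ?_
  filter_upwards [hn.eventually_lt_const one_pos] with k hk using hbound k hk

end OrliczConvergence

/-- Convergence in measure of finitely many components. -/
lemma tendstoInMeasure_pi {α ι κ : Type*} [MeasurableSpace α] {μ : Measure α} [Fintype κ]
    {L : Filter ι} {f : ι → α → κ → ℝ} {g : α → κ → ℝ}
    (h : ∀ i, TendstoInMeasure μ (fun k x => f k x i) L (fun x => g x i)) :
    TendstoInMeasure μ f L g := by
  rw [tendstoInMeasure_iff_norm]
  intro ε hε
  have hsum : Tendsto (fun k => ∑ i, μ {x | ε ≤ ‖f k x i - g x i‖}) L (𝓝 0) := by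
    simpa using tendsto_finsetSum Finset.univ
      fun i _ => tendstoInMeasure_iff_norm.1 (h i) ε hε
  refine tendsto_of_tendsto_of_tendsto_of_le_of_le tendsto_const_nhds hsum
    (fun _ => zero_le) fun k => ?_
  -- If the sup norm is at least `ε`, then some coordinate is, so a union bound suffices.
  refine le_trans (measure_mono fun x hx => ?_) (measure_iUnion_fintype_le μ _)
  by_contra hcon
  simp only [mem_iUnion, mem_ofPred_eq, not_exists, not_le] at hcon
  exact (not_lt.2 hx) ((pi_norm_lt_iff hε).2 hcon)

/-! ### Convexity and semicontinuity of the energy. -/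

section Energy

variable {n : ℕ} {Φ : YoungFunction} {Ω : Set (EuclideanSpace ℝ (Fin n))} {hΩ : IsOpen Ω}

lemma OrliczSobolev.aemeasurable_grad (u : OrliczSobolev Φ hΩ) :
    AEMeasurable (OrliczSobolev.grad u) (volume.restrict Ω) := by
  refine (WithLp.measurable_toLp 2 (Fin n → ℝ)).comp_aemeasurable ?_
  exact aemeasurable_pi_lambda _ fun i => (u.1.2 i).1.aestronglyMeasurable.aemeasurable

/-- Gradients are read off from chosen representatives of classes, so their linearity survives only
almost everywhere. -/
lemma OrliczSobolev.grad_add_smul (u v : OrliczSobolev Φ hΩ) (s t : ℝ) :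
    ∀ᵐ x ∂(volume.restrict Ω), OrliczSobolev.grad (s • u + t • v) x =
      s • OrliczSobolev.grad u x + t • OrliczSobolev.grad v x := by
  have h : ∀ᵐ x ∂(volume.restrict Ω), ∀ i,
      ((s • u + t • v).1.2 i).1 x = s * (u.1.2 i).1 x + t * (v.1.2 i).1 x := by
    refine ae_all_iff.2 fun i => ?_
    filter_upwards [AEEqFun.coeFn_add (s • (u.1.2 i).1) (t • (v.1.2 i).1),
      AEEqFun.coeFn_smul s (u.1.2 i).1, AEEqFun.coeFn_smul t (v.1.2 i).1] with x h1 h2 h3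
    change (s • (u.1.2 i).1 + t • (v.1.2 i).1 : _ →ₘ[volume.restrict Ω] ℝ) x = _
    rw [h1, Pi.add_apply, h2, h3]
    rfl
  filter_upwards [h] with x hx
  ext i
  exact hx i

/-- A norm convergent sequence has a subsequence whose gradients converge almost everywhere. -/
lemma OrliczSobolev.exists_subseq_grad_tendsto {u : ℕ → OrliczSobolev Φ hΩ}
    {v : OrliczSobolev Φ hΩ} (h : Tendsto u atTop (𝓝 v)) :
    ∃ ns : ℕ → ℕ, StrictMono ns ∧ ∀ᵐ x ∂(volume.restrict Ω),
      Tendsto (fun k => OrliczSobolev.grad (u (ns k)) x) atTop (𝓝 (OrliczSobolev.grad v x)) := by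
  have hi : ∀ i, Tendsto (fun k => (u k).1.2 i) atTop (𝓝 (v.1.2 i)) := fun i =>
    (((continuous_apply i).comp continuous_snd).comp continuous_subtype_val).continuousAt.tendsto.comp
      h
  obtain ⟨ns, hns, hae⟩ := (tendstoInMeasure_pi (f := fun k x i => ((u k).1.2 i).1 x)
    (g := fun x i => (v.1.2 i).1 x)
    fun i => OrliczSpace.tendstoInMeasure (hi i)).exists_seq_tendsto_ae
  refine ⟨ns, hns, hae.mono fun x hx => ?_⟩
  -- The convergence found is in the sup norm on `Fin n → ℝ`; continuity of `toLp` moves it to the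
  -- Euclidean space.
  exact ((PiLp.continuous_toLp 2 fun _ : Fin n => ℝ).tendsto _).comp hx

variable {c₁ c₂ : ℝ} {f : EuclideanSpace ℝ (Fin n) → EuclideanSpace ℝ (Fin n) → ℝ}

lemma IsConvexIntegrand.aemeasurable_comp_grad (hf : IsConvexIntegrand Φ Ω c₁ c₂ f)
    (u : OrliczSobolev Φ hΩ) :
    AEMeasurable (fun x => ENNReal.ofReal (f x (OrliczSobolev.grad u x))) (volume.restrict Ω) :=
  (aemeasurable_superposition hf.continuous hf.measurable (OrliczSobolev.aemeasurable_grad u)).ennreal_ofReal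

lemma IsConvexIntegrand.energy_convex (hf : IsConvexIntegrand Φ Ω c₁ c₂ f)
    (u v : OrliczSobolev Φ hΩ) {s t : ℝ} (hs : 0 ≤ s) (ht : 0 ≤ t) (hst : s + t = 1) :
    energy f (s • u + t • v) ≤
      ENNReal.ofReal s * energy f u + ENNReal.ofReal t * energy f v := by
  unfold energy
  rw [← lintegral_const_mul' _ _ ENNReal.ofReal_ne_top,
    ← lintegral_const_mul' _ _ ENNReal.ofReal_ne_top,
    ← lintegral_add_left' ((hf.aemeasurable_comp_grad u).const_mul _)]
  refine lintegral_mono_ae ?_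
  filter_upwards [OrliczSobolev.grad_add_smul u v s t, ae_restrict_mem hΩ.measurableSet]
    with x hx hxΩ
  rw [hx, ← ENNReal.ofReal_mul hs, ← ENNReal.ofReal_mul ht]
  exact (ENNReal.ofReal_le_ofReal
    ((hf.convex x hxΩ).2 (mem_univ _) (mem_univ _) hs ht hst)).trans ENNReal.ofReal_add_le

lemma IsConvexIntegrand.convex_sublevel (hf : IsConvexIntegrand Φ Ω c₁ c₂ f) (y : ℝ≥0∞) :
    Convex ℝ {u : OrliczSobolev Φ hΩ | energy f u ≤ y} := by
  intro u hu v hv s t hs ht hst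
  refine (hf.energy_convex u v hs ht hst).trans ?_
  calc ENNReal.ofReal s * energy f u + ENNReal.ofReal t * energy f v
      ≤ ENNReal.ofReal s * y + ENNReal.ofReal t * y :=
        add_le_add (mul_le_mul_right hu _) (mul_le_mul_right hv _)
    _ = y := by rw [← add_mul, ← ENNReal.ofReal_add hs ht, hst, ENNReal.ofReal_one, one_mul]

/-- Fatou's lemma along an almost everywhere convergent subsequence. Passing to a subsequence costs
nothing, since every term has energy at most `y`, and sequences suffice because the norm topology is
metrizable. -/
lemma IsConvexIntegrand.isClosed_sublevel (hf : IsConvexIntegrand Φ Ω c₁ c₂ f) (y : ℝ≥0∞) :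
    IsClosed {u : OrliczSobolev Φ hΩ | energy f u ≤ y} := by
  refine IsSeqClosed.isClosed fun u v hu huv => ?_
  obtain ⟨ns, -, hae⟩ := OrliczSobolev.exists_subseq_grad_tendsto huv
  calc energy f v
      = ∫⁻ x in Ω, liminf (fun k => ENNReal.ofReal (f x (OrliczSobolev.grad (u (ns k)) x)))
          atTop := by
        refine lintegral_congr_ae ?_
        filter_upwards [hae, hf.continuous] with x hx hfx
        exact (ENNReal.tendsto_ofReal ((hfx.tendsto _).comp hx)).liminf_eq.symm
    _ ≤ liminf (fun k => energy f (u (ns k))) atTop :=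
        lintegral_liminf_le' fun k => hf.aemeasurable_comp_grad _
    _ ≤ y := liminf_le_of_frequently_le' (Frequently.of_forall fun k => hu (ns k))

lemma IsConvexIntegrand.lowerSemicontinuous_energy (hf : IsConvexIntegrand Φ Ω c₁ c₂ f) :
    LowerSemicontinuous (fun w : WeakSpace ℝ (OrliczSobolev Φ hΩ) =>
      energy f ((toWeakSpace ℝ (OrliczSobolev Φ hΩ)).symm w)) := by
  refine lowerSemicontinuous_iff_isClosed_preimage.2 fun y => ?_
  -- Mazur's theorem: the norm and weak closures of a convex set agree, so a norm closed sublevel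
  -- set equals its weak closure.
  have h := (hf.convex_sublevel (hΩ := hΩ) y).toWeakSpace_closure ℝ
  rw [(hf.isClosed_sublevel y).closure_eq, LinearEquiv.image_eq_preimage_symm] at h
  exact isClosed_of_closure_subset h.ge

end Energy

theorem proposition1 {n : ℕ} (Φ : YoungFunction) {Ω : Set (EuclideanSpace ℝ (Fin n))}
    (hΩ : IsOpen Ω) {c₁ c₂ : ℝ} (hc₁ : 0 < c₁) (hc₂ : 0 < c₂)
    (f : EuclideanSpace ℝ (Fin n) → EuclideanSpace ℝ (Fin n) → ℝ)
    (hf : IsConvexIntegrand Φ Ω c₁ c₂ f) :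
    LowerSemicontinuous (fun w : WeakSpace ℝ (OrliczSobolev Φ hΩ) =>
        energy f ((toWeakSpace ℝ (OrliczSobolev Φ hΩ)).symm w)) ∧
    ∀ (u : ℕ → OrliczSobolev Φ hΩ) (u₀ : OrliczSobolev Φ hΩ),
      Tendsto (fun k => toWeakSpace ℝ (OrliczSobolev Φ hΩ) (u k)) atTop
        (𝓝 (toWeakSpace ℝ (OrliczSobolev Φ hΩ) u₀)) →
      energy f u₀ ≤ liminf (fun k => energy f (u k)) atTop := by
  refine ⟨hf.lowerSemicontinuous_energy, fun u u₀ h => ?_⟩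
  -- Lower semicontinuity bounds the energy at `u₀` by the lower limit along the weak neighbourhood
  -- filter; the filter of the sequence is finer, and its lower limit is therefore at least as
  -- large.
  exact (hf.lowerSemicontinuous_energy.le_liminf (toWeakSpace ℝ (OrliczSobolev Φ hΩ) u₀)).trans
    (liminf_le_liminf_of_le h)
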